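/- Let $d\ge 1$ and $n\ge 1$ be integers and let $S\subset\mathbb{R}^d$ be a set of $(d+1)n$ points in general position (no $d+1$ points of $S$ lie on a common hyperplane), coloured with the colours $0,1,\dots,d$ so that (i) there are exactly $n$ points of each colour; (ii) for every directed line, i.e. for every direction $v\in\mathbb{R}^d\setminus\{0\}$, there are colours $i<j$ such that the farthest point of colour $i$ in the direction $v$ is at least as far in that direction as every point of colour $j$: $\max\{\langle v,p\rangle : p\in S \text{ of colour } i\}\ \ge\ \langle v,q\rangle$ for every $q\in S$ of colour $j$. Then there is a balanced hyperplane: a hyperplane $h$ containing no point of $S$ such that each of the two open half-spaces bounded by $h$ contains the same number of points of every colour, and this number is positive for both half-spaces. In other words, for some $1\le k\le n-1$ one open side of $h$ contains exactly $k$ points and the other exactly $n-k$ points of each colour. -/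

import Mathlib

namespace BalancedCut

/-- `ℝ^d` with its Euclidean structure. -/
abbrev Space (d : ℕ) : Type := EuclideanSpace ℝ (Fin d)

/-- A finite set of points of `ℝ^d` is in general position if no `d + 1` distinct points of it lie
on a common hyperplane, that is, any `d + 1` of its points are affinely independent. -/
def GeneralPosition {d : ℕ} (S : Finset (Space d)) : Prop :=
  ∀ T : Finset (Space d), T ⊆ S → T.card = d + 1 →
    AffineIndependent ℝ (fun x : T => (x : Space d))

/-- The points of `S` of colour `i`, for a colouring `c` of which only the values on `S` matter. -/
def colorClass {d : ℕ} (S : Finset (Space d)) (c : Space d → Fin (d + 1)) (i : Fin (d + 1)) :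
    Finset (Space d) :=
  S.filter (fun x => c x = i)

/-- `p` is a farthest point of the set `A` in the direction `v`. -/
def IsFarthest {d : ℕ} (v : Space d) (A : Finset (Space d)) (p : Space d) : Prop :=
  p ∈ A ∧ ∀ q ∈ A, inner ℝ v q ≤ inner ℝ v p

/-- For every directed line (only its direction `v ≠ 0` matters) there are colours `i < j` such
that the farthest point of colour `i` is at least as far as every point of colour `j`. -/
def NotPermuted {d : ℕ} (S : Finset (Space d)) (c : Space d → Fin (d + 1)) : Prop :=
  ∀ v : Space d, v ≠ 0 → ∃ i j : Fin (d + 1), i < j ∧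
    ∃ p, IsFarthest v (colorClass S c i) p ∧
      ∀ q ∈ colorClass S c j, inner ℝ v q ≤ inner ℝ v p

/-- The hyperplane `{x | ⟪v, x⟫ = b}` is balanced: `v ≠ 0`, no point of `S` lies on it, and each of
its two open sides contains the same number of points of every colour. These numbers are
required to be positive, since otherwise any hyperplane with all of `S` on one side would do. -/
def IsBalanced {d : ℕ} (S : Finset (Space d)) (c : Space d → Fin (d + 1))
    (v : Space d) (b : ℝ) : Prop :=
  v ≠ 0 ∧ (∀ x ∈ S, inner ℝ v x ≠ b) ∧
    (∃ k : ℕ, 0 < k ∧ ∀ i, ((colorClass S c i).filter (fun x => b < inner ℝ v x)).card = k) ∧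
    (∃ l : ℕ, 0 < l ∧ ∀ i, ((colorClass S c i).filter (fun x => inner ℝ v x < b)).card = l)

end BalancedCut

/-! Encode the hyperplane `⟪v, x⟫ = b` by `y = (v, b)` on the unit sphere of `Space d × ℝ`, a space
of dimension `d + 1`; passing to `-y` swaps its sides. For each colour, the sum of the heights
clamped to `[-ε, ε]` is a continuous odd substitute for `ε (#above - #below)`. By Borsuk-Ulam
(`exists_zero_of_odd`) the `d + 1` sums agree somewhere, but perhaps only where all of `S` lies on
one side. So `testFun` adds an odd correction, supported on hyperplanes strictly beyond `S`.
Agreement of the corrected sums there would force the colour maxima to increase strictly with the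
colour, which `NotPermuted` forbids, or a degenerate hyperplane, which general position and small
`ε` forbid (`le_totalMax_of_testFun`).

By general position at most `d` points are close to a hyperplane, so some colour has none close.
Hence the common sum is exactly `ε (2k - n)` for an integer `k` with `0 < k < n`
(`exists_clampSum_eq`). The close points can be pushed to any prescribed sides
(`exists_perturbation`), so every colour can be given exactly `k` points above.

Borsuk-Ulam rests on a parity count: in any iterated barycentric subdivision of a hemisphere of the
cross-polytope, an odd number of simplices is detected by the iterated cup product of the sign
changes of the `d` coordinates (`hemiSum_subdiv_signChange`). On a small such simplex all
coordinates are nearly zero, and compactness concludes. Everything is done dually, on cochains, so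
no subdivided complex is built. -/

namespace BorsukUlam

/-! ### Mod 2 cochains on lists -/

/-- A mod 2 cochain on ordered simplices, a simplex being the list of its vertices. -/
abbrev Cochain (V : Type*) : Type _ := List V → ZMod 2

section Algebra

variable {V : Type*}

/-- The cochain `φ` evaluated on the cone with apex `b`. -/
def cone (b : V) (φ : Cochain V) : Cochain V := fun τ => φ (b :: τ)

/-- The (augmented) coboundary: the sum of the values on all facets. -/
def coboundary : Cochain V → Cochain V
  | _, [] => 0
  | φ, b :: τ => φ τ + coboundary (fun t => φ (b :: t)) τ

lemma coboundary_nil (φ : Cochain V) : coboundary φ [] = 0 := rfl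

lemma coboundary_cons (φ : Cochain V) (b : V) (τ : List V) :
    coboundary φ (b :: τ) = φ τ + coboundary (cone b φ) τ := rfl

/-- The cone homotopy formula; the recursive form of `coboundary` makes it definitional, and it
drives the inductions below. -/
lemma cone_coboundary (φ : Cochain V) (b : V) :
    cone b (coboundary φ) = φ + coboundary (cone b φ) := rfl

lemma cone_add (b : V) (φ ψ : Cochain V) : cone b (φ + ψ) = cone b φ + cone b ψ := rfl

lemma coboundary_add (φ ψ : Cochain V) :
    coboundary (φ + ψ) = coboundary φ + coboundary ψ := by
  funext σ
  induction σ generalizing φ ψ with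
  | nil => simp [coboundary_nil]
  | cons b τ ih =>
    simp only [Pi.add_apply, coboundary_cons, cone_add, ih]
    ring

lemma coboundary_const_mul (a : ZMod 2) (φ : Cochain V) (σ : List V) :
    coboundary (fun τ => a * φ τ) σ = a * coboundary φ σ := by
  induction σ generalizing φ with
  | nil => simp [coboundary_nil]
  | cons b τ ih =>
    simp only [coboundary_cons, mul_add]
    congr 1
    exact ih (cone b φ)

lemma coboundary_coboundary (φ : Cochain V) : coboundary (coboundary φ) = 0 := by
  funext σ
  induction σ generalizing φ with
  | nil => rfl
  | cons b τ ih =>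
    rw [coboundary_cons, cone_coboundary, coboundary_add, Pi.add_apply, ih, Pi.zero_apply,
      add_zero]
    exact CharTwo.add_self_eq_zero _

lemma coboundary_comp_map (ν : V → V) (φ : Cochain V) (σ : List V) :
    coboundary (fun τ => φ (τ.map ν)) σ = coboundary φ (σ.map ν) := by
  induction σ generalizing φ with
  | nil => rfl
  | cons b τ ih =>
    rw [List.map_cons, coboundary_cons, coboundary_cons, ← ih]
    rfl

lemma exists_of_coboundary_ne_zero {φ : Cochain V} {σ : List V} (h : coboundary φ σ ≠ 0) :
    ∃ τ, φ τ ≠ 0 ∧ τ ⊆ σ ∧ τ.length + 1 = σ.length := by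
  induction σ generalizing φ with
  | nil => exact absurd rfl h
  | cons b τ ih =>
    by_cases h0 : φ τ = 0
    · rw [coboundary_cons, h0, zero_add] at h
      obtain ⟨ρ, h1, h2, h3⟩ := ih h
      exact ⟨b :: ρ, h1, List.cons_subset_cons b h2, by simp [h3]⟩
    · exact ⟨τ, h0, List.subset_cons_self b τ, rfl⟩

/-! ### Barycentric subdivision of cochains -/

/-- The dual of barycentric subdivision on simplices with `k` vertices, where `bar` chooses the
barycentre of a simplex. -/
def subdiv (bar : List V → V) : ℕ → Cochain V → Cochain V
  | 0, φ => φ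
  | k + 1, φ => fun σ => coboundary (subdiv bar k (cone (bar σ) φ)) σ

lemma subdiv_add (bar : List V → V) (k : ℕ) (φ ψ : Cochain V) :
    subdiv bar k (φ + ψ) = subdiv bar k φ + subdiv bar k ψ := by
  induction k generalizing φ ψ with
  | zero => rfl
  | succ k ih =>
    funext σ
    simp only [subdiv, cone_add, ih, coboundary_add, Pi.add_apply]

/-- Subdivision is a cochain map: coning `coboundary φ` gives `φ` plus a coboundary, and the latter
is killed by the outer coboundary. -/
lemma subdiv_coboundary (bar : List V → V) (k : ℕ) (φ : Cochain V) :
    subdiv bar (k + 1) (coboundary φ) = coboundary (subdiv bar k φ) := by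
  induction k generalizing φ with
  | zero =>
    funext σ
    simp only [subdiv]
    rw [cone_coboundary, coboundary_add, coboundary_coboundary, add_zero]
  | succ k ih =>
    funext σ
    change coboundary (subdiv bar (k + 1) (cone (bar σ) (coboundary φ))) σ = _
    rw [cone_coboundary, subdiv_add, ih, coboundary_add, coboundary_coboundary, add_zero]

lemma subdiv_comp_map {bar : List V → V} {ν : V → V}
    (hbar : ∀ σ, σ ≠ [] → bar (σ.map ν) = ν (bar σ)) (k : ℕ) (φ : Cochain V) :
    subdiv bar k (fun τ => φ (τ.map ν)) = fun σ => subdiv bar k φ (σ.map ν) := by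
  induction k generalizing φ with
  | zero => rfl
  | succ k ih =>
    funext σ
    rcases eq_or_ne σ [] with rfl | hσ
    · rfl
    simp only [subdiv]
    rw [hbar σ hσ, ← coboundary_comp_map, ← ih]
    rfl

/-! ### Cup products detecting sign changes -/

/-- The cup product of the function `u` with the cochain `φ`. -/
def cup (u : V → ZMod 2) (φ : Cochain V) : Cochain V
  | [] => 0
  | x :: τ => u x * φ (x :: τ)

/-- The cup product of the coboundaries of a list of functions. -/
def signChange : List (V → ZMod 2) → Cochain V
  | [] => coboundary (fun σ => if σ = [] then 1 else 0)
  | u :: us => coboundary (cup u (signChange us))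

lemma coboundary_signChange (us : List (V → ZMod 2)) :
    coboundary (signChange us) = 0 := by
  cases us <;> exact coboundary_coboundary _

lemma signChange_nil (us : List (V → ZMod 2)) : signChange us [] = 0 := by
  cases us <;> rfl

/-- Since `signChange us` is a cocycle, the Leibniz rule leaves only the cup product of the
coboundary of `u` with it. -/
lemma signChange_cons_cons (u : V → ZMod 2) (us : List (V → ZMod 2)) (x : V) (τ : List V) :
    signChange (u :: us) (x :: τ) = cup u (signChange us) τ + u x * signChange us τ := by
  have h := congrFun (coboundary_signChange us) (x :: τ)
  rw [coboundary_cons, Pi.zero_apply] at h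
  have h' : coboundary (cone x (signChange us)) τ = signChange us τ :=
    (CharTwo.add_eq_zero.mp h).symm
  rw [signChange, coboundary_cons]
  congr 1
  rw [← h']
  exact coboundary_const_mul (u x) (cone x (signChange us)) τ

lemma exists_of_signChange_ne_zero {us : List (V → ZMod 2)} {σ : List V}
    (h : signChange us σ ≠ 0) : σ ≠ [] ∧ ∀ u ∈ us, ∃ x ∈ σ, ∃ y ∈ σ, u x ≠ u y := by
  refine ⟨fun h0 => h (h0 ▸ signChange_nil us), ?_⟩
  induction us generalizing σ with
  | nil => simp
  | cons u us ih =>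
    match σ with
    | [] => exact absurd (signChange_nil _) h
    | [x] => simp [signChange_cons_cons, cup, signChange_nil] at h
    | x :: y :: τ =>
      rw [signChange_cons_cons, cup, ← add_mul] at h
      have h1 := left_ne_zero_of_mul h
      have h2 := right_ne_zero_of_mul h
      intro w hw
      rcases List.mem_cons.mp hw with rfl | hw
      · exact ⟨y, by simp, x, by simp, fun e => h1 (CharTwo.add_eq_zero.mpr e)⟩
      · obtain ⟨p, hp, q, hq, hpq⟩ := ih h2 w hw
        exact ⟨p, List.mem_cons_of_mem _ hp, q, List.mem_cons_of_mem _ hq, hpq⟩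

lemma cup_comp_map {ν : V → V} {u : V → ZMod 2} (hu : ∀ x, u (ν x) = u x + 1) {φ : Cochain V}
    (hφ : ∀ σ, φ (σ.map ν) = φ σ) (h0 : φ [] = 0) (σ : List V) :
    cup u φ (σ.map ν) = cup u φ σ + φ σ := by
  cases σ with
  | nil => simp [cup, h0]
  | cons x τ =>
    have := hφ (x :: τ)
    rw [List.map_cons] at this
    rw [List.map_cons, cup, cup, hu, this]
    ring

lemma signChange_comp_map {ν : V → V} {us : List (V → ZMod 2)}
    (hu : ∀ u ∈ us, ∀ x, u (ν x) = u x + 1) (σ : List V) :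
    signChange us (σ.map ν) = signChange us σ := by
  induction us generalizing σ with
  | nil =>
    rw [signChange, ← coboundary_comp_map]
    simp
  | cons u us ih =>
    have ih' := ih (fun w hw => hu w (List.mem_cons_of_mem _ hw))
    have h2 : (fun τ => cup u (signChange us) (τ.map ν))
        = cup u (signChange us) + signChange us := by
      funext τ
      exact cup_comp_map (hu u List.mem_cons_self) ih' (signChange_nil us) τ
    rw [signChange, ← coboundary_comp_map, h2, coboundary_add, coboundary_signChange, add_zero]

/-! ### Sums over the cross-polytope and its hemispheres -/

/-- The sum of the values of a cochain over all simplices obtained from a list of vertices by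
applying the involution `ν` to some of them. -/
def crossSum (ν : V → V) : List V → Cochain V → ZMod 2
  | [], φ => φ []
  | e :: es, φ => crossSum ν es (cone e φ) + crossSum ν es (cone (ν e) φ)

/-- The same sum, in which the first vertex is left alone. -/
def hemiSum (ν : V → V) : List V → Cochain V → ZMod 2
  | [], _ => 0
  | e :: es, φ => crossSum ν es (cone e φ)

lemma crossSum_add (ν : V → V) (es : List V) (φ ψ : Cochain V) :
    crossSum ν es (φ + ψ) = crossSum ν es φ + crossSum ν es ψ := by
  induction es generalizing φ ψ with
  | nil => rfl
  | cons e es ih =>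
    simp only [crossSum, cone_add, ih]
    ring

lemma crossSum_coboundary (ν : V → V) (es : List V) (φ : Cochain V) :
    crossSum ν es (coboundary φ) = 0 := by
  induction es generalizing φ with
  | nil => rfl
  | cons e es ih =>
    simp only [crossSum, cone_coboundary, crossSum_add, ih, add_zero]
    exact CharTwo.add_self_eq_zero _

/-- Stokes: the boundary of the hemisphere is the equator. -/
lemma hemiSum_coboundary (ν : V → V) (e : V) (es : List V) (φ : Cochain V) :
    hemiSum ν (e :: es) (coboundary φ) = crossSum ν es φ := by
  rw [hemiSum, cone_coboundary, crossSum_add, crossSum_coboundary, add_zero]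

lemma crossSum_comp_map {ν : V → V} (hν : ∀ x, ν (ν x) = x) (es : List V) (φ : Cochain V) :
    crossSum ν es (fun σ => φ (σ.map ν)) = crossSum ν es φ := by
  induction es generalizing φ with
  | nil => rfl
  | cons e es ih =>
    have h : ∀ b, cone b (fun σ => φ (σ.map ν)) = fun σ => cone (ν b) φ (σ.map ν) :=
      fun _ => rfl
    simp only [crossSum, h, ih, hν]
    ring

lemma crossSum_eq_hemiSum_add {ν : V → V} (hν : ∀ x, ν (ν x) = x) (e : V) (es : List V)
    (φ : Cochain V) : crossSum ν (e :: es) φ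
      = hemiSum ν (e :: es) φ + hemiSum ν (e :: es) (fun σ => φ (σ.map ν)) := by
  rw [crossSum, hemiSum, hemiSum]
  congr 1
  exact (crossSum_comp_map hν es (cone (ν e) φ)).symm

lemma hemiSum_add (ν : V → V) (es : List V) (φ ψ : Cochain V) :
    hemiSum ν es (φ + ψ) = hemiSum ν es φ + hemiSum ν es ψ := by
  cases es with
  | nil => simp [hemiSum]
  | cons e es => simp [hemiSum, cone_add, crossSum_add]

lemma exists_of_crossSum_ne_zero {ν : V → V} {es : List V} {φ : Cochain V}
    (h : crossSum ν es φ ≠ 0) :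
    ∃ σ, φ σ ≠ 0 ∧ List.Forall₂ (fun e x => x = e ∨ x = ν e) es σ := by
  induction es generalizing φ with
  | nil => exact ⟨[], h, List.Forall₂.nil⟩
  | cons e es ih =>
    by_cases h0 : crossSum ν es (cone e φ) = 0
    · rw [crossSum, h0, zero_add] at h
      obtain ⟨σ, h1, h2⟩ := ih h
      exact ⟨_, h1, List.Forall₂.cons (Or.inr rfl) h2⟩
    · obtain ⟨σ, h1, h2⟩ := ih h0
      exact ⟨_, h1, List.Forall₂.cons (Or.inl rfl) h2⟩

lemma exists_of_hemiSum_ne_zero {ν : V → V} {es : List V} {φ : Cochain V}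
    (h : hemiSum ν es φ ≠ 0) :
    ∃ σ, φ σ ≠ 0 ∧ List.Forall₂ (fun e x => x = e ∨ x = ν e) es σ := by
  cases es with
  | nil => exact absurd rfl h
  | cons e es =>
    obtain ⟨σ, h1, h2⟩ := exists_of_crossSum_ne_zero h
    exact ⟨_, h1, List.Forall₂.cons (Or.inl rfl) h2⟩

lemma iterate_subdiv_add (bar : List V → V) (k N : ℕ) (φ ψ : Cochain V) :
    (subdiv bar k)^[N] (φ + ψ) = (subdiv bar k)^[N] φ + (subdiv bar k)^[N] ψ := by
  induction N generalizing φ ψ with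
  | zero => rfl
  | succ N ih => simp only [Function.iterate_succ_apply, subdiv_add, ih]

lemma iterate_subdiv_coboundary (bar : List V → V) (k N : ℕ) (φ : Cochain V) :
    (subdiv bar (k + 1))^[N] (coboundary φ) = coboundary ((subdiv bar k)^[N] φ) := by
  induction N generalizing φ with
  | zero => rfl
  | succ N ih => simp only [Function.iterate_succ_apply, subdiv_coboundary, ih]

lemma iterate_subdiv_comp_map {bar : List V → V} {ν : V → V}
    (hbar : ∀ σ, σ ≠ [] → bar (σ.map ν) = ν (bar σ)) (k N : ℕ) (φ : Cochain V) :
    (subdiv bar k)^[N] (fun τ => φ (τ.map ν)) = fun σ => (subdiv bar k)^[N] φ (σ.map ν) := by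
  induction N generalizing φ with
  | zero => rfl
  | succ N ih => simp only [Function.iterate_succ_apply, subdiv_comp_map hbar, ih]

/-- In every iterated barycentric subdivision of a hemisphere of the cross-polytope, the number of
simplices along which the given odd functions successively change is odd. -/
theorem hemiSum_subdiv_signChange {bar : List V → V} {ν : V → V} (hν : ∀ x, ν (ν x) = x)
    (hbar : ∀ σ, σ ≠ [] → bar (σ.map ν) = ν (bar σ)) (N : ℕ) (us : List (V → ZMod 2))
    (hu : ∀ u ∈ us, ∀ x, u (ν x) = u x + 1) (es : List V) (hes : es.length = us.length + 1) :
    hemiSum ν es ((subdiv bar es.length)^[N] (signChange us)) = 1 := by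
  induction us generalizing es with
  | nil =>
    obtain ⟨e, rfl⟩ := List.length_eq_one_iff.mp hes
    rw [List.length_singleton, signChange, iterate_subdiv_coboundary, hemiSum_coboundary]
    have h : ∀ φ : Cochain V, (subdiv bar 0)^[N] φ = φ := fun φ =>
      Function.iterate_fixed rfl N
    rw [h]
    rfl
  | cons u us ih =>
    match es, hes with
    | e :: e' :: es, hes =>
      have ih' := ih (fun w hw => hu w (List.mem_cons_of_mem _ hw)) (e' :: es) (by simpa using hes)
      have h2 : (fun τ => cup u (signChange us) (τ.map ν))
          = cup u (signChange us) + signChange us := by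
        funext τ
        exact cup_comp_map (hu u List.mem_cons_self)
          (signChange_comp_map fun w hw => hu w (List.mem_cons_of_mem _ hw)) (signChange_nil us) τ
      -- Stokes moves the sum to the equator, which splits into two antipodal hemispheres. By `h2`
      -- the cup products on them cancel mod 2 and leave the count for `us`.
      rw [List.length_cons, signChange, iterate_subdiv_coboundary, hemiSum_coboundary,
        crossSum_eq_hemiSum_add hν, ← iterate_subdiv_comp_map hbar, h2, iterate_subdiv_add,
        hemiSum_add, ih', ← add_assoc, CharTwo.add_self_eq_zero, zero_add]

end Algebra

/-! ### Centroids and shrinking diameters -/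

section Geometry

variable {E : Type*} [NormedAddCommGroup E] [NormedSpace ℝ E]

/-- The centroid of a list of points. -/
noncomputable def centroid (l : List E) : E := (l.length : ℝ)⁻¹ • l.sum

lemma centroid_map_neg (l : List E) : centroid (l.map Neg.neg) = -centroid l := by
  have h : (l.map Neg.neg).sum = -l.sum := by
    induction l with
    | nil => simp
    | cons a l ih => simp only [List.map_cons, List.sum_cons, ih]; abel
  rw [centroid, centroid, h, List.length_map, smul_neg]

lemma sum_sub_const (l : List E) (x : E) :
    (l.map fun y => y - x).sum = l.sum - (l.length : ℝ) • x := by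
  induction l with
  | nil => simp
  | cons a l ih =>
    simp only [List.map_cons, List.sum_cons, ih, List.length_cons, Nat.cast_add, Nat.cast_one,
      add_smul, one_smul]
    abel

lemma norm_list_sum_le {G : Type*} [SeminormedAddCommGroup G] {l : List G} {D : ℝ} (h : ∀ y ∈ l, ‖y‖ ≤ D) :
    ‖l.sum‖ ≤ l.length * D := by
  induction l with
  | nil => simp
  | cons a l ih =>
    have h1 := ih fun y hy => h y (List.mem_cons_of_mem _ hy)
    have h2 := h a List.mem_cons_self
    rw [List.sum_cons, List.length_cons]
    push_cast
    linarith [norm_add_le a l.sum]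

lemma dist_centroid_le {l : List E} {D : ℝ} (h : ∀ x ∈ l, ∀ y ∈ l, dist x y ≤ D) {x : E}
    (hx : x ∈ l) : dist x (centroid l) ≤ (1 - (l.length : ℝ)⁻¹) * D := by
  obtain ⟨l', hl'⟩ : ∃ l', l.Perm (x :: l') := by
    classical exact ⟨l.erase x, List.perm_cons_erase hx⟩
  have hlen : (l.length : ℝ) = l'.length + 1 := by rw [hl'.length_eq]; simp
  have hpos : (0 : ℝ) < l'.length + 1 := by positivity
  have h1 : centroid l - x = (l.length : ℝ)⁻¹ • (l'.map fun y => y - x).sum := by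
    rw [sum_sub_const, centroid, hl'.sum_eq, List.sum_cons, hlen]
    have : x = ((l'.length : ℝ) + 1)⁻¹ • (((l'.length : ℝ) + 1) • x) := by
      rw [smul_smul, inv_mul_cancel₀ hpos.ne', one_smul]
    conv_lhs => rw [this]
    simp only [← smul_sub]
    rw [← this, add_smul, one_smul]
    congr 1
    abel
  have h2 : ‖(l'.map fun y => y - x).sum‖ ≤ l'.length * D := by
    have := norm_list_sum_le (l := l'.map fun y => y - x) (D := D) (by
      intro z hz
      obtain ⟨y, hy, rfl⟩ := List.mem_map.mp hz
      rw [← dist_eq_norm]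
      exact h y (hl'.mem_iff.mpr (List.mem_cons_of_mem _ hy)) x hx)
    simpa using this
  rw [dist_comm, dist_eq_norm, h1, norm_smul, hlen, norm_inv, Real.norm_of_nonneg hpos.le]
  have h3 : (1 - ((l'.length : ℝ) + 1)⁻¹) * D
      = ((l'.length : ℝ) + 1)⁻¹ * (l'.length * D) := by
    field_simp
    ring
  rw [h3]
  exact mul_le_mul_of_nonneg_left h2 (by positivity)

lemma centroid_mem {l : List E} (hl : l ≠ []) {C : Set E} (hC : Convex ℝ C)
    (h : ∀ x ∈ l, x ∈ C) : centroid l ∈ C := by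
  induction l with
  | nil => exact absurd rfl hl
  | cons a l ih =>
    rcases eq_or_ne l [] with rfl | hl'
    · simpa [centroid] using h
    have h1 := ih hl' fun x hx => h x (List.mem_cons_of_mem _ hx)
    have hpos : (0 : ℝ) < l.length := by exact_mod_cast List.length_pos_iff.mpr hl'
    have h2 : centroid (a :: l) = ((l.length : ℝ) + 1)⁻¹ • a
        + (l.length * ((l.length : ℝ) + 1)⁻¹) • centroid l := by
      rw [centroid, centroid, smul_smul, List.sum_cons, smul_add, List.length_cons]
      push_cast
      congr 2
      field_simp
    rw [h2]
    refine hC (h a List.mem_cons_self) h1 (by positivity) (by positivity) ?_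
    field_simp
    ring

/-- Subdivided simplices stay in convex sets, and their diameter shrinks. -/
lemma exists_of_subdiv_ne_zero {V : Type*} {bar : List V → V} {pos : V → E}
    (hbar : ∀ σ, pos (bar σ) = centroid (σ.map pos)) {k : ℕ} {φ : Cochain V} {σ : List V}
    (hk : σ.length = k) (h : subdiv bar k φ σ ≠ 0) :
    ∃ τ, φ τ ≠ 0 ∧ τ.length = k ∧
      (∀ C : Set E, Convex ℝ C → (∀ x ∈ σ, pos x ∈ C) → ∀ x ∈ τ, pos x ∈ C) ∧
      ∀ D : ℝ, (∀ x ∈ σ, ∀ y ∈ σ, dist (pos x) (pos y) ≤ D) →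
        ∀ x ∈ τ, ∀ y ∈ τ, dist (pos x) (pos y) ≤ (1 - (k : ℝ)⁻¹) * D := by
  induction k generalizing φ σ with
  | zero =>
    obtain rfl := List.length_eq_zero_iff.mp hk
    exact ⟨[], h, rfl, by simp, by simp⟩
  | succ k ih =>
    obtain ⟨σ', h1, h2, h3⟩ := exists_of_coboundary_ne_zero h
    obtain ⟨τ, t1, t2, t3, t4⟩ := ih (by omega) h1
    have hσ : σ ≠ [] := by rintro rfl; simp at hk
    refine ⟨bar σ :: τ, t1, by simp [t2], ?_, ?_⟩
    · intro C hC hx x hxτ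
      rcases List.mem_cons.mp hxτ with rfl | hxτ
      · rw [hbar]
        exact centroid_mem (by simpa using hσ) hC (by simpa using hx)
      · exact t3 C hC (fun x hx' => hx x (h2 hx')) x hxτ
    · intro D hD
      have hD0 : 0 ≤ D := by
        obtain ⟨x, hx⟩ := List.exists_mem_of_ne_nil σ hσ
        simpa using hD x hx x hx
      have hr : 0 ≤ (1 - ((k + 1 : ℕ) : ℝ)⁻¹) * D := by
        refine mul_nonneg ?_ hD0
        rw [sub_nonneg]
        exact inv_le_one_of_one_le₀ (by push_cast; linarith [Nat.cast_nonneg (α := ℝ) k])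
      -- A ball around the barycentre contains the facet `σ'`, and by convexity all subdivision
      -- vertices in it.
      have hb : ∀ x ∈ τ, dist (pos x) (pos (bar σ)) ≤ (1 - ((k + 1 : ℕ) : ℝ)⁻¹) * D := by
        refine t3 (Metric.closedBall (pos (bar σ)) ((1 - ((k + 1 : ℕ) : ℝ)⁻¹) * D))
          (convex_closedBall _ _) ?_
        intro x hx
        have := dist_centroid_le (l := σ.map pos) (D := D) (by simpa using hD)
          (List.mem_map_of_mem (h2 hx))
        rw [List.length_map, hk] at this
        rw [Metric.mem_closedBall, hbar]
        exact this
      have ht : ∀ x ∈ τ, ∀ y ∈ τ, dist (pos x) (pos y) ≤ (1 - ((k + 1 : ℕ) : ℝ)⁻¹) * D := by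
        intro x hx y hy
        refine (t4 D (fun x hx y hy => hD x (h2 hx) y (h2 hy)) x hx y hy).trans ?_
        refine mul_le_mul_of_nonneg_right ?_ hD0
        have hk0 : 0 < k := by
          rw [← t2]
          exact List.length_pos_of_mem hx
        have : ((k + 1 : ℕ) : ℝ)⁻¹ ≤ (k : ℝ)⁻¹ := by
          refine inv_anti₀ (by exact_mod_cast hk0) (by push_cast; linarith)
        linarith
      intro x hx y hy
      rcases List.mem_cons.mp hx with rfl | hx <;> rcases List.mem_cons.mp hy with rfl | hy
      · simpa using hr
      · rw [dist_comm]; exact hb y hy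
      · exact hb x hx
      · exact ht x hx y hy

lemma exists_of_iterate_subdiv_ne_zero {V : Type*} {bar : List V → V} {pos : V → E}
    (hbar : ∀ σ, pos (bar σ) = centroid (σ.map pos)) {k : ℕ} (N : ℕ) {φ : Cochain V} {σ : List V}
    (hk : σ.length = k) (h : (subdiv bar k)^[N] φ σ ≠ 0) :
    ∃ τ, φ τ ≠ 0 ∧
      (∀ C : Set E, Convex ℝ C → (∀ x ∈ σ, pos x ∈ C) → ∀ x ∈ τ, pos x ∈ C) ∧
      ∀ D : ℝ, (∀ x ∈ σ, ∀ y ∈ σ, dist (pos x) (pos y) ≤ D) →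
        ∀ x ∈ τ, ∀ y ∈ τ, dist (pos x) (pos y) ≤ (1 - (k : ℝ)⁻¹) ^ N * D := by
  induction N generalizing σ with
  | zero => exact ⟨σ, h, fun _ _ h => h, by simp⟩
  | succ N ih =>
    rw [Function.iterate_succ_apply'] at h
    obtain ⟨σ', h1, h2, h3, h4⟩ := exists_of_subdiv_ne_zero hbar hk h
    obtain ⟨τ, t1, t2, t3⟩ := ih h2 h1
    refine ⟨τ, t1, fun C hC hx => t2 C hC (h3 C hC hx), fun D hD x hx y hy => ?_⟩
    rw [pow_succ, mul_assoc]
    exact t3 _ (h4 D hD) x hx y hy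

end Geometry

/-! ### The Borsuk-Ulam theorem -/

section Main

variable {d : ℕ}

/-- Vertices carry a sign besides their position, which makes the antipode free. -/
abbrev Vertex (d : ℕ) : Type := (Fin (d + 1) → ℝ) × Bool

def Vertex.antipode (x : Vertex d) : Vertex d := (-x.1, !x.2)

/-- The sign is copied from the first vertex so that barycentres commute with the antipode. The
default is harmless: this is needed only for nonempty lists. -/
noncomputable def Vertex.barycentre (σ : List (Vertex d)) : Vertex d :=
  (centroid (σ.map Prod.fst), (σ.map Prod.snd).headD true)

/-- The sign of an odd function, where zeros take the sign of the vertex. -/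
noncomputable def signOf (f : (Fin (d + 1) → ℝ) → ℝ) (x : Vertex d) : ZMod 2 :=
  if 0 < f x.1 then 1 else if f x.1 < 0 then 0 else if x.2 then 1 else 0

lemma signOf_antipode {f : (Fin (d + 1) → ℝ) → ℝ} (hf : ∀ x, f (-x) = -f x) (x : Vertex d) :
    signOf f x.antipode = signOf f x + 1 := by
  have h2 : (1 : ZMod 2) + 1 = 0 := rfl
  rcases lt_trichotomy (f x.1) 0 with h | h | h
  · simp [signOf, Vertex.antipode, hf, h, h.not_gt]
  · rcases hx : x.2 <;> simp [signOf, Vertex.antipode, hf, h, hx, h2]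
  · simp [signOf, Vertex.antipode, hf, h, h.not_gt, h2]

lemma mul_nonpos_of_signOf_ne {f : (Fin (d + 1) → ℝ) → ℝ} {x y : Vertex d}
    (h : signOf f x ≠ signOf f y) : f x.1 * f y.1 ≤ 0 := by
  by_contra hlt
  push Not at hlt
  apply h
  rcases pos_and_pos_or_neg_and_neg_of_mul_pos hlt with ⟨h1, h2⟩ | ⟨h1, h2⟩
  · simp [signOf, h1, h2]
  · simp [signOf, h1, h2, h1.not_gt, h2.not_gt]

lemma barycentre_map_antipode (σ : List (Vertex d)) (hσ : σ ≠ []) :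
    Vertex.barycentre (σ.map Vertex.antipode) = (Vertex.barycentre σ).antipode := by
  obtain ⟨x, σ, rfl⟩ := List.exists_cons_of_ne_nil hσ
  have h : ((x :: σ).map Vertex.antipode).map Prod.fst
      = ((x :: σ).map Prod.fst).map Neg.neg := by
    rw [List.map_map, List.map_map]
    rfl
  refine Prod.ext ?_ rfl
  change centroid _ = _
  rw [h, centroid_map_neg]
  rfl

/-- The vertices of the cross-polytope with positive coordinates. -/
def crossVertices (l : List (Fin (d + 1))) : List (Vertex d) :=
  l.map fun i => (Pi.single i 1, true)

/-- Each axis occurs at most once, so the choices of vertex or antipode combine into one sign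
vector. -/
lemma exists_signs {l : List (Fin (d + 1))} (hl : l.Nodup) {σ : List (Vertex d)}
    (h : List.Forall₂ (fun e x => x = e ∨ x = Vertex.antipode e) (crossVertices l) σ) :
    ∃ s : Fin (d + 1) → ℝ, (∀ i, |s i| = 1) ∧
      ∀ x ∈ σ, ∃ i ∈ l, x.1 = s i • (Pi.single i 1 : Fin (d + 1) → ℝ) := by
  induction l generalizing σ with
  | nil =>
    cases h
    exact ⟨fun _ => 1, by simp, by simp⟩
  | cons i l ih =>
    obtain ⟨hi, hl⟩ := List.nodup_cons.mp hl
    cases h with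
    | cons hx hσ =>
      obtain ⟨s, hs, h⟩ := ih hl hσ
      rename_i x τ
      obtain ⟨r, hr, hxr⟩ : ∃ r : ℝ, |r| = 1 ∧ x.1 = r • (Pi.single i 1 : Fin (d + 1) → ℝ) := by
        rcases hx with rfl | rfl
        · exact ⟨1, by simp, by simp⟩
        · exact ⟨-1, by simp, by simp [Vertex.antipode]⟩
      refine ⟨Function.update s i r, fun j => ?_, fun y hy => ?_⟩
      · by_cases hj : j = i
        · subst hj; simpa using hr
        · simpa [hj] using hs j
      · rcases List.mem_cons.mp hy with rfl | hy
        · exact ⟨i, List.mem_cons_self, by simpa using hxr⟩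
        · obtain ⟨j, hj, e⟩ := h y hy
          have hji : j ≠ i := fun e => hi (e ▸ hj)
          exact ⟨j, List.mem_cons_of_mem _ hj, by simpa [hji] using e⟩

/-- A compact neighbourhood of the boundary of the cross-polytope. -/
def crossShell (d : ℕ) : Set (Fin (d + 1) → ℝ) :=
  Metric.closedBall 0 1 ∩ {x | 1 ≤ ∑ i, |x i|}

lemma isCompact_crossShell (d : ℕ) : IsCompact (crossShell d) := by
  refine (isCompact_closedBall _ _).inter_right (isClosed_le continuous_const ?_)
  fun_prop

lemma exists_small_simplex (us : List (Vertex d → ZMod 2)) (hlen : us.length = d)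
    (hu : ∀ u ∈ us, ∀ x, u (Vertex.antipode x) = u x + 1) (N : ℕ) :
    ∃ τ : List (Vertex d), τ ≠ [] ∧ (∀ u ∈ us, ∃ x ∈ τ, ∃ y ∈ τ, u x ≠ u y) ∧
      (∀ x ∈ τ, x.1 ∈ crossShell d) ∧
      ∀ x ∈ τ, ∀ y ∈ τ, dist x.1 y.1 ≤ (1 - ((d + 1 : ℕ) : ℝ)⁻¹) ^ N * 2 := by
  have hl : (crossVertices (List.finRange (d + 1))).length = d + 1 := by simp [crossVertices]
  have h1 := hemiSum_subdiv_signChange (bar := Vertex.barycentre (d := d))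
    (ν := Vertex.antipode) (by intro x; simp [Vertex.antipode]) barycentre_map_antipode N us hu
    (crossVertices (List.finRange (d + 1))) (by rw [hl, hlen])
  obtain ⟨σ, h2, h3⟩ := exists_of_hemiSum_ne_zero (h1 ▸ one_ne_zero)
  obtain ⟨s, hs, hσ⟩ := exists_signs (List.nodup_finRange _) h3
  rw [hl] at h2
  obtain ⟨τ, t1, t2, t3⟩ := exists_of_iterate_subdiv_ne_zero (pos := Prod.fst) (fun _ => rfl) N
    (by rw [← h3.length_eq, hl]) h2
  obtain ⟨t4, t5⟩ := exists_of_signChange_ne_zero t1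
  have hσ1 : ∀ x ∈ σ, x.1 ∈ Metric.closedBall (0 : Fin (d + 1) → ℝ) 1 := by
    intro x hx
    obtain ⟨i, -, e⟩ := hσ x hx
    rw [mem_closedBall_zero_iff, e, norm_smul, Real.norm_eq_abs, hs, Pi.norm_single]
    simp
  -- This half-space is convex and avoids the origin, so subdivision stays in `crossShell`.
  have hσ2 : ∀ x ∈ σ, x.1 ∈ {x : Fin (d + 1) → ℝ | 1 ≤ ∑ i, s i * x i} := by
    intro x hx
    obtain ⟨i, -, e⟩ := hσ x hx
    have : s i * s i = 1 := by rw [← abs_mul_abs_self, hs, one_mul]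
    simp [e, Pi.single_apply, this]
  have hconv : Convex ℝ {x : Fin (d + 1) → ℝ | 1 ≤ ∑ i, s i * x i} := by
    refine convex_halfSpace_ge ⟨fun x y => ?_, fun a x => ?_⟩ 1
    · simp [mul_add, Finset.sum_add_distrib]
    · simp only [Pi.smul_apply, smul_eq_mul, Finset.mul_sum]
      exact Finset.sum_congr rfl fun i _ => by ring
  refine ⟨τ, t4, t5, fun x hx => ⟨t2 _ (convex_closedBall _ _) hσ1 x hx, ?_⟩, t3 2 ?_⟩
  · have : 1 ≤ ∑ i, s i * x.1 i := t2 _ hconv hσ2 x hx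
    refine this.trans (Finset.sum_le_sum fun i _ => ?_)
    calc s i * x.1 i ≤ |s i * x.1 i| := le_abs_self _
      _ = |x.1 i| := by rw [abs_mul, hs, one_mul]
  · intro x hx y hy
    have h1 := mem_closedBall_zero_iff.mp (hσ1 x hx)
    have h2 := mem_closedBall_zero_iff.mp (hσ1 y hy)
    rw [dist_eq_norm]
    linarith [norm_sub_le x.1 y.1]

lemma exists_zero_of_odd_pi {f : (Fin (d + 1) → ℝ) → Fin d → ℝ} (hf : ContinuousOn f {0}ᶜ)
    (hodd : ∀ x, f (-x) = -f x) : ∃ x, x ≠ 0 ∧ f x = 0 := by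
  by_contra! hne
  have hK : ∀ x ∈ crossShell d, x ≠ 0 := by
    rintro x ⟨-, hx⟩ rfl
    norm_num at hx
  have hfK : ContinuousOn f (crossShell d) := hf.mono fun x hx => hK x hx
  have hcpt := isCompact_crossShell d
  obtain ⟨m, hm, hmf⟩ : ∃ m : ℝ, 0 < m ∧ ∀ x ∈ crossShell d, m ≤ ‖f x‖ := by
    rcases (crossShell d).eq_empty_or_nonempty with h | h
    · exact ⟨1, one_pos, by simp [h]⟩
    · obtain ⟨z, hz, hmin⟩ := hcpt.exists_isMinOn h hfK.norm
      exact ⟨‖f z‖, norm_pos_iff.mpr (hne z (hK z hz)), fun x hx => hmin hx⟩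
  have huc := hcpt.uniformContinuousOn_of_continuous hfK
  obtain ⟨δ, hδ, hfδ⟩ := Metric.uniformContinuousOn_iff.mp huc (m / 3) (by positivity)
  have hr0 : 0 ≤ 1 - ((d + 1 : ℕ) : ℝ)⁻¹ := by
    rw [sub_nonneg]
    exact inv_le_one_of_one_le₀ (by push_cast; linarith [Nat.cast_nonneg (α := ℝ) d])
  have hr1 : 1 - ((d + 1 : ℕ) : ℝ)⁻¹ < 1 := by
    have : 0 < ((d + 1 : ℕ) : ℝ)⁻¹ := by positivity
    linarith
  obtain ⟨N, hN⟩ := exists_pow_lt_of_lt_one (show 0 < δ / 2 by positivity) hr1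
  obtain ⟨τ, t1, t2, t3, t4⟩ := exists_small_simplex (d := d)
    ((List.finRange d).map fun j => signOf fun x => f x j) (by simp) (by
      intro u hu
      obtain ⟨j, -, rfl⟩ := List.mem_map.mp hu
      exact signOf_antipode fun x => by rw [hodd]; rfl) N
  obtain ⟨z, hz⟩ := List.exists_mem_of_ne_nil τ t1
  have hclose : ∀ x ∈ τ, ∀ y ∈ τ, ∀ j, |f x.1 j - f y.1 j| ≤ m / 3 := by
    intro x hx y hy j
    have h1 := hfδ x.1 (t3 x hx) y.1 (t3 y hy) ((t4 x hx y hy).trans_lt (by linarith))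
    rw [← Real.dist_eq]
    exact (dist_le_pi_dist _ _ j).trans h1.le
  -- Each coordinate has weakly opposite signs at two vertices of `τ`, while it varies by at most `m
  -- / 3` on `τ`.
  have hle : ‖f z.1‖ ≤ 2 * (m / 3) := by
    refine (pi_norm_le_iff_of_nonneg (by positivity)).mpr fun j => ?_
    obtain ⟨x, hx, y, hy, hxy⟩ := t2 _ (List.mem_map_of_mem (List.mem_finRange j))
    have h1 := mul_nonpos_of_signOf_ne hxy
    have h2 := abs_le.mp (hclose x hx y hy j)
    have h3 := abs_le.mp (hclose z hz x hx j)
    have h4 := abs_le.mp (hclose z hz y hy j)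
    rw [Real.norm_eq_abs, abs_le]
    rcases mul_nonpos_iff.mp h1 with ⟨h5, h6⟩ | ⟨h5, h6⟩ <;> constructor <;> linarith
  linarith [hmf z.1 (t3 z hz)]

/-- The Borsuk-Ulam theorem for the unit sphere of a normed space of dimension `d + 1`. -/
theorem exists_zero_of_odd {E : Type*} [NormedAddCommGroup E] [NormedSpace ℝ E]
    (hE : Module.finrank ℝ E = d + 1) {f : E → Fin d → ℝ}
    (hf : ContinuousOn f (Metric.sphere 0 1)) (hodd : ∀ x, f (-x) = -f x) :
    ∃ x, ‖x‖ = 1 ∧ f x = 0 := by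
  have : FiniteDimensional ℝ E := Module.finite_of_finrank_eq_succ hE
  let A : (Fin (d + 1) → ℝ) ≃L[ℝ] E := ContinuousLinearEquiv.ofFinrankEq (by simp [hE])
  let g : (Fin (d + 1) → ℝ) → E := fun x => ‖A x‖⁻¹ • A x
  have hg : ∀ x, x ≠ 0 → ‖g x‖ = 1 := by
    intro x hx
    have h : ‖A x‖ ≠ 0 := by simpa using hx
    simp only [g, norm_smul, norm_inv, norm_norm]
    exact inv_mul_cancel₀ h
  obtain ⟨x, hx, h⟩ := exists_zero_of_odd_pi (f := f ∘ g) (by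
    refine hf.comp ?_ fun x hx => mem_sphere_zero_iff_norm.mpr (hg x hx)
    refine ContinuousOn.smul (ContinuousOn.inv₀ (by fun_prop) ?_) (by fun_prop)
    intro x hx
    simpa using hx) (by
    intro x
    have : g (-x) = -g x := by simp [g]
    simp only [Function.comp_apply, this, hodd])
  exact ⟨g x, hg x hx, h⟩

end Main

end BorsukUlam

namespace BalancedCut

open Finset

variable {d : ℕ}

/-! ### Heights of points above hyperplanes -/

/-- The signed height of the point `p` above the hyperplane with coefficients `y`. -/
noncomputable def height (y : Space d × ℝ) (p : Space d) : ℝ := inner ℝ y.1 p - y.2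

lemma height_neg (y : Space d × ℝ) (p : Space d) : height (-y) p = -height y p := by
  simp [height]
  ring

lemma height_add (y z : Space d × ℝ) (p : Space d) :
    height (y + z) p = height y p + height z p := by
  simp [height, inner_add_left]
  ring

lemma height_smul (a : ℝ) (y : Space d × ℝ) (p : Space d) :
    height (a • y) p = a * height y p := by
  simp [height, inner_smul_left]
  ring

lemma continuous_height (p : Space d) : Continuous fun y : Space d × ℝ => height y p := by
  unfold height
  fun_prop

lemma abs_height_le (y : Space d × ℝ) (p : Space d) : |height y p| ≤ ‖y‖ * (‖p‖ + 1) := by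
  have h1 := abs_real_inner_le_norm y.1 p
  have h2 : ‖y.1‖ * ‖p‖ ≤ ‖y‖ * ‖p‖ :=
    mul_le_mul_of_nonneg_right (norm_fst_le y) (norm_nonneg p)
  have h3 : |y.2| ≤ ‖y‖ := norm_snd_le y
  unfold height
  linarith [abs_sub (inner ℝ y.1 p) y.2]

/-- The heights of the points of `T`, as a linear function of the hyperplane. -/
noncomputable def heights (T : Finset (Space d)) : (Space d × ℝ) →ₗ[ℝ] (T → ℝ) where
  toFun y p := height y p
  map_add' y z := funext fun p => height_add y z p
  map_smul' a y := funext fun p => height_smul a y p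

/-- The normal `y.1` is orthogonal to all differences of points of `T`; these span the space, so it
is orthogonal to itself. -/
lemma eq_zero_of_height_eq_zero {T : Finset (Space d)} (hT : T.card = d + 1)
    (haff : AffineIndependent ℝ (fun x : T => (x : Space d))) {y : Space d × ℝ}
    (hy : ∀ p ∈ T, height y p = 0) : y = 0 := by
  have htop : vectorSpan ℝ (Set.range fun x : T => (x : Space d)) = ⊤ := by
    refine haff.vectorSpan_eq_top_of_card_eq_finrank_add_one ?_
    simp [hT]
  have hle : vectorSpan ℝ (Set.range fun x : T => (x : Space d))
      ≤ LinearMap.ker (innerₛₗ ℝ y.1) := by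
    rw [vectorSpan_def, Submodule.span_le]
    rintro _ ⟨_, ⟨p, rfl⟩, _, ⟨q, rfl⟩, rfl⟩
    have h1 := hy p p.2
    have h2 := hy q q.2
    unfold height at h1 h2
    simp only [SetLike.mem_coe, LinearMap.mem_ker, innerₛₗ_apply_apply, vsub_eq_sub,
      inner_sub_right]
    linarith
  have hv : y.1 = 0 := by
    have : y.1 ∈ LinearMap.ker (innerₛₗ ℝ y.1) := hle (htop ▸ Submodule.mem_top)
    simpa using this
  obtain ⟨p, hp⟩ : T.Nonempty := by rw [← card_pos]; omega
  have h := hy p hp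
  simp only [height, hv, inner_zero_left, zero_sub, neg_eq_zero] at h
  exact Prod.ext hv h

lemma heights_injective {T : Finset (Space d)} (hT : T.card = d + 1)
    (haff : AffineIndependent ℝ (fun x : T => (x : Space d))) :
    Function.Injective (heights T) := by
  rw [injective_iff_map_eq_zero]
  intro y hy
  exact eq_zero_of_height_eq_zero hT haff fun p hp => congrFun hy ⟨p, hp⟩

lemma exists_height_eq {T : Finset (Space d)} (hT : T.card = d + 1)
    (haff : AffineIndependent ℝ (fun x : T => (x : Space d))) (a : Space d → ℝ) :
    ∃ y, ∀ p ∈ T, height y p = a p := by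
  have hsurj : Function.Surjective (heights T) :=
    (LinearMap.injective_iff_surjective_of_finrank_eq_finrank (by simp [hT])).mp
      (heights_injective hT haff)
  obtain ⟨y, hy⟩ := hsurj fun p => a p
  exact ⟨y, fun p hp => congrFun hy ⟨p, hp⟩⟩

/-- No hyperplane passes close to `d + 1` points in general position. -/
lemma exists_height_bound {S : Finset (Space d)} (hS : GeneralPosition S) :
    ∃ δ : ℝ, 0 < δ ∧ ∀ T ⊆ S, T.card = d + 1 → ∀ y, ∃ p ∈ T, δ * ‖y‖ ≤ |height y p| := by
  -- Holding for all small `δ`, the bound can be met for the finitely many `T` at once.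
  have key : ∀ T ∈ S.powersetCard (d + 1), ∀ᶠ δ : ℝ in nhdsWithin 0 (Set.Ioi 0),
      ∀ y, ∃ p ∈ T, δ * ‖y‖ ≤ |height y p| := by
    intro T hT
    obtain ⟨hTS, hcard⟩ := mem_powersetCard.mp hT
    have hinj := heights_injective hcard (hS T hTS hcard)
    obtain ⟨K, hK, hanti⟩ := (heights T).exists_antilipschitzWith (LinearMap.ker_eq_bot.mpr hinj)
    have hK' : (0 : ℝ) < K := hK
    have : Nonempty T := by
      rw [← Fintype.card_pos_iff, Fintype.card_coe]
      omega
    filter_upwards [Ioc_mem_nhdsGT (inv_pos.mpr hK')] with δ hδ y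
    have h1 : ‖y‖ ≤ K * ‖heights T y‖ := by
      simpa using hanti.le_mul_dist y 0
    obtain ⟨p, hp⟩ := Finite.exists_max fun p : T => ‖heights T y p‖
    have h2 : ‖heights T y‖ ≤ |height y p| := (pi_norm_le_iff_of_nonneg (abs_nonneg _)).mpr hp
    refine ⟨p, p.2, ?_⟩
    calc δ * ‖y‖ ≤ (K : ℝ)⁻¹ * ‖y‖ := mul_le_mul_of_nonneg_right hδ.2 (norm_nonneg y)
      _ ≤ (K : ℝ)⁻¹ * (K * |height y p|) := by gcongr; exact h1.trans (by gcongr)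
      _ = |height y p| := by rw [← mul_assoc, inv_mul_cancel₀ hK'.ne', one_mul]
  obtain ⟨δ, h, hδ⟩ := (((Filter.eventually_all_finset _).mpr key).and
    (self_mem_nhdsWithin : Set.Ioi (0 : ℝ) ∈ nhdsWithin 0 (Set.Ioi 0))).exists
  exact ⟨δ, hδ, fun T hT hcard => h T (mem_powersetCard.mpr ⟨hT, hcard⟩)⟩

/-! ### Truncated height sums -/

/-- The sum over `A` of the heights truncated to `[-ε, ε]`. -/
noncomputable def clampSum (A : Finset (Space d)) (ε : ℝ) (y : Space d × ℝ) : ℝ :=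
  ∑ p ∈ A, max (-ε) (min ε (height y p))

lemma continuous_clampSum (A : Finset (Space d)) (ε : ℝ) : Continuous (clampSum A ε) :=
  continuous_finsetSum _ fun p _ =>
    continuous_const.max (continuous_const.min (continuous_height p))

lemma clampSum_neg (A : Finset (Space d)) {ε : ℝ} (hε : 0 ≤ ε) (y : Space d × ℝ) :
    clampSum A ε (-y) = -clampSum A ε y := by
  rw [clampSum, clampSum, ← sum_neg_distrib]
  refine sum_congr rfl fun p _ => ?_
  rw [height_neg]
  grind

lemma le_clampSum (A : Finset (Space d)) (ε : ℝ) (y : Space d × ℝ) :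
    -ε * A.card ≤ clampSum A ε y := by
  have := A.card_nsmul_le_sum (fun p => max (-ε) (min ε (height y p))) (-ε)
    fun p _ => le_max_left _ _
  rw [nsmul_eq_mul] at this
  rw [clampSum]
  linarith

lemma clampSum_eq_iff {A : Finset (Space d)} {ε : ℝ} (hε : 0 < ε) {y : Space d × ℝ} :
    clampSum A ε y = -ε * A.card ↔ ∀ p ∈ A, height y p ≤ -ε := by
  have h : -ε * A.card = ∑ _p ∈ A, -ε := by rw [sum_const, nsmul_eq_mul, mul_comm]
  rw [h, clampSum, eq_comm, sum_eq_sum_iff_of_le fun p _ => le_max_left _ _]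
  refine forall₂_congr fun p _ => ?_
  grind

lemma sum_two_mul_indicator (A : Finset (Space d)) (ε : ℝ) (P : Space d → Prop)
    [DecidablePred P] :
    ∑ p ∈ A, (if P p then ε else -ε) = ε * (2 * (A.filter P).card - A.card) := by
  have h := card_filter_add_card_filter_not (s := A) P
  rw [sum_ite, sum_const, sum_const, nsmul_eq_mul, nsmul_eq_mul, ← h]
  push_cast
  ring

/-- The clamp lies between the two `±ε`-valued step functions that jump at `ε` and at `-ε`. -/
lemma card_le_of_clampSum {A : Finset (Space d)} {ε : ℝ} (hε : 0 < ε) {y : Space d × ℝ} {k : ℕ}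
    (h : clampSum A ε y = ε * (2 * k - A.card)) :
    (A.filter fun p => ε ≤ height y p).card ≤ k ∧
      k ≤ (A.filter fun p => -ε < height y p).card := by
  have h1 : ∑ p ∈ A, (if ε ≤ height y p then ε else -ε) ≤ clampSum A ε y :=
    sum_le_sum fun p _ => by grind
  have h2 : clampSum A ε y ≤ ∑ p ∈ A, (if -ε < height y p then ε else -ε) :=
    sum_le_sum fun p _ => by grind
  rw [sum_two_mul_indicator, h] at h1 h2
  have h3 := le_of_mul_le_mul_left h1 hε
  have h4 := le_of_mul_le_mul_left h2 hε
  constructor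
  · have : ((A.filter fun p => ε ≤ height y p).card : ℝ) ≤ k := by linarith
    exact_mod_cast this
  · have : (k : ℝ) ≤ (A.filter fun p => -ε < height y p).card := by linarith
    exact_mod_cast this

lemma clampSum_eq_of_abs {A : Finset (Space d)} {ε : ℝ} (hε : 0 < ε) {y : Space d × ℝ}
    (h : ∀ p ∈ A, ε ≤ |height y p|) :
    clampSum A ε y = ε * (2 * (A.filter fun p => 0 < height y p).card - A.card) := by
  rw [← sum_two_mul_indicator, clampSum]
  refine sum_congr rfl fun p hp => ?_
  have := h p hp
  grind

/-! ### Perturbation -/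

/-- A hyperplane can be moved slightly so that the points close to it come to lie on prescribed
sides. -/
lemma exists_perturbation {S : Finset (Space d)} (hS : GeneralPosition S) (hcard : d + 1 ≤ S.card)
    {δ : ℝ} (hδ : ∀ T ⊆ S, T.card = d + 1 → ∀ y, ∃ p ∈ T, δ * ‖y‖ ≤ |height y p|)
    (hδ0 : 0 < δ) {R : ℝ} (hR : ∀ p ∈ S, ‖p‖ + 1 ≤ R) {ε : ℝ} (hε : 0 < ε) (hεδ : ε < δ)
    (hεR : 2 * ε * R < δ * δ) {y : Space d × ℝ} (hy : ‖y‖ = 1) (B : Finset (Space d))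
    (hB : ∀ p ∈ S, p ∈ B → -ε < height y p) (hB' : ∀ p ∈ S, p ∉ B → height y p < ε) :
    ∃ z, ∀ p ∈ S, (p ∈ B → 0 < height z p) ∧ (p ∉ B → height z p < 0) := by
  classical
  have hT : (S.filter fun p => |height y p| < δ).card ≤ d + 1 := by
    by_contra! hlt
    obtain ⟨T, hT, hT'⟩ := exists_subset_card_eq hlt.le
    obtain ⟨p, hp, h⟩ := hδ T (hT.trans (filter_subset _ _)) hT' y
    have := (mem_filter.mp (hT hp)).2
    rw [hy, mul_one] at h
    linarith
  -- The close points are padded to exactly `d + 1`, on which heights can be prescribed freely.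
  obtain ⟨T, hTT, hTS, hTcard⟩ := exists_subsuperset_card_eq (filter_subset _ S) hT hcard
  obtain ⟨z, hz⟩ := exists_height_eq hTcard (hS T hTS hTcard) fun p =>
    if |height y p| < ε then (if p ∈ B then ε else -ε) - height y p else 0
  -- The general position bound, applied to `z` itself, shows that the move is small, hence harmless
  -- for points outside `T`.
  have hz_norm : δ * ‖z‖ ≤ 2 * ε := by
    obtain ⟨p, hp, h⟩ := hδ T hTS hTcard z
    refine h.trans ?_
    rw [hz p hp]
    split_ifs with h1 h2
    · grind
    · grind
    · simpa using hε.le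
  refine ⟨y + z, fun p hp => ?_⟩
  rw [height_add]
  by_cases hpT : p ∈ T
  · rw [hz p hpT]
    by_cases hpB : p ∈ B
    · have h1 := hB p hp hpB
      simp only [hpB, not_true, if_true, false_imp_iff, true_imp_iff, and_true]
      generalize height y p = t at h1
      grind
    · have h1 := hB' p hp hpB
      simp only [hpB, not_false_eq_true, if_false, false_imp_iff, true_imp_iff, true_and]
      generalize height y p = t at h1
      grind
  · have h1 : δ ≤ |height y p| := by
      by_contra! hlt
      exact hpT (hTT (mem_filter.mpr ⟨hp, hlt⟩))
    have h2 : |height z p| < δ := by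
      have h3 : |height z p| ≤ ‖z‖ * R :=
        (abs_height_le z p).trans (mul_le_mul_of_nonneg_left (hR p hp) (norm_nonneg z))
      have hR0 : 0 ≤ R := by linarith [hR p hp, norm_nonneg p]
      have h4 : δ * (‖z‖ * R) ≤ 2 * ε * R := by
        rw [← mul_assoc]
        exact mul_le_mul_of_nonneg_right hz_norm hR0
      exact h3.trans_lt (lt_of_mul_lt_mul_left (h4.trans_lt hεR) hδ0.le)
    have h3 := hB p hp
    have h4 := hB' p hp
    generalize height y p = t at *
    generalize height z p = r at *
    by_cases hpB : p ∈ B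
    · have h5 := h3 hpB
      simp only [hpB, not_true, false_imp_iff, true_imp_iff, and_true]
      clear * - h1 h2 h5 hεδ
      grind
    · have h5 := h4 hpB
      simp only [hpB, not_false_eq_true, false_imp_iff, true_imp_iff, true_and]
      clear * - h1 h2 h5 hεδ
      grind

/-! ### The test function -/

section TestFunction

variable {A : Fin (d + 1) → Finset (Space d)} (hA : ∀ i, (A i).Nonempty)

/-- The largest value of `⟪v, ·⟫` on the class `i`. -/
noncomputable def classMax (i : Fin (d + 1)) (v : Space d) : ℝ :=
  (A i).sup' (hA i) fun p => inner ℝ v p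

/-- The largest value of `⟪v, ·⟫` on all classes. -/
noncomputable def totalMax (v : Space d) : ℝ :=
  univ.sup' univ_nonempty fun i => classMax hA i v

lemma continuous_classMax (i : Fin (d + 1)) : Continuous (classMax hA i) :=
  Continuous.finset_sup'_apply (hA i) fun p _ => by fun_prop

lemma continuous_totalMax : Continuous (totalMax hA) :=
  Continuous.finset_sup'_apply univ_nonempty fun i _ => continuous_classMax hA i

lemma exists_classMax (i : Fin (d + 1)) (v : Space d) :
    ∃ p ∈ A i, classMax hA i v = inner ℝ v p :=
  exists_mem_eq_sup' (hA i) _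

lemma le_classMax {i : Fin (d + 1)} (v : Space d) {p : Space d} (hp : p ∈ A i) :
    inner ℝ v p ≤ classMax hA i v :=
  le_sup' (fun p => inner ℝ v p) hp

lemma classMax_le_totalMax (i : Fin (d + 1)) (v : Space d) :
    classMax hA i v ≤ totalMax hA v :=
  le_sup' (fun i => classMax hA i v) (mem_univ i)

lemma exists_totalMax (v : Space d) : ∃ i, totalMax hA v = classMax hA i v := by
  obtain ⟨i, -, h⟩ := exists_mem_eq_sup' univ_nonempty fun i => classMax hA i v
  exact ⟨i, h⟩

lemma classMax_zero (i : Fin (d + 1)) : classMax hA i 0 = 0 := by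
  obtain ⟨p, -, h⟩ := exists_classMax hA i 0
  simpa using h

/-- The correction of the truncated height sums at hyperplanes above all points. -/
noncomputable def capTerm (ε : ℝ) (i : Fin (d + 1)) (y : Space d × ℝ) : ℝ :=
  max 0 (y.2 - totalMax hA y.1) * classMax hA i y.1
    - max 0 (y.2 - totalMax hA y.1 - ε) * (i : ℕ)

/-- An odd function on hyperplanes which is equal for all classes only at almost balanced ones. -/
noncomputable def testFun (ε : ℝ) (i : Fin (d + 1)) (y : Space d × ℝ) : ℝ :=
  clampSum (A i) ε y + capTerm hA ε i y - capTerm hA ε i (-y)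

lemma continuous_capTerm (ε : ℝ) (i : Fin (d + 1)) : Continuous (capTerm hA ε i) := by
  have h1 := continuous_classMax hA i
  have h2 := continuous_totalMax hA
  unfold capTerm
  fun_prop

lemma continuous_testFun (ε : ℝ) (i : Fin (d + 1)) : Continuous (testFun hA ε i) := by
  have h1 := continuous_capTerm hA ε i
  have h2 := continuous_clampSum (A i) ε
  unfold testFun
  fun_prop

lemma testFun_neg {ε : ℝ} (hε : 0 ≤ ε) (i : Fin (d + 1)) (y : Space d × ℝ) :
    testFun hA ε i (-y) = -testFun hA ε i y := by
  rw [testFun, testFun, clampSum_neg _ hε, neg_neg]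
  ring

lemma capTerm_eq_zero {ε : ℝ} (hε : 0 ≤ ε) {i : Fin (d + 1)} {y : Space d × ℝ}
    (h : y.2 ≤ totalMax hA y.1) : capTerm hA ε i y = 0 := by
  rw [capTerm, max_eq_left (by linarith), max_eq_left (by linarith)]
  ring

/-- For every hyperplane some class has no point close to it. -/
lemma exists_class_far {S : Finset (Space d)} (hAS : ∀ i, A i ⊆ S)
    (hdisj : ∀ i j, i ≠ j → Disjoint (A i) (A j)) {δ : ℝ}
    (hδ : ∀ T ⊆ S, T.card = d + 1 → ∀ y, ∃ p ∈ T, δ * ‖y‖ ≤ |height y p|)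
    (y : Space d × ℝ) : ∃ i, ∀ p ∈ A i, δ * ‖y‖ ≤ |height y p| := by
  classical
  by_contra! h
  choose p hp hlt using h
  have hinj : Function.Injective p := by
    intro i j hij
    by_contra hne
    exact disjoint_left.mp (hdisj i j hne) (hp i) (hij ▸ hp j)
  obtain ⟨q, hq, hle⟩ := hδ (univ.image p) (by
    intro x hx
    obtain ⟨i, -, rfl⟩ := mem_image.mp hx
    exact hAS i (hp i)) (by rw [card_image_of_injective _ hinj]; simp) y
  obtain ⟨i, -, rfl⟩ := mem_image.mp hq
  exact absurd (hlt i) hle.not_gt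

/-- Beyond all points, let `α > 0` be the gap. If `α ≤ ε`, the weights `α * classMax` force all
maxima to be equal; if `α > ε`, the clamped sums are all minimal and the colour index in `capTerm`
forces strictly increasing maxima. -/
lemma le_totalMax_of_testFun {S : Finset (Space d)} {n : ℕ} (hd : 1 ≤ d) (hAS : ∀ i, A i ⊆ S)
    (hdisj : ∀ i j, i ≠ j → Disjoint (A i) (A j)) (hcard : ∀ i, (A i).card = n)
    (hperm : ∀ v : Space d, v ≠ 0 → ∃ i j, i < j ∧ classMax hA j v ≤ classMax hA i v) {δ : ℝ}
    (hδ : ∀ T ⊆ S, T.card = d + 1 → ∀ y, ∃ p ∈ T, δ * ‖y‖ ≤ |height y p|)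
    (hδ0 : 0 < δ) {ε : ℝ} (hε : 0 < ε) (hεδ : ε < δ) (hε1 : ε < 1) {y : Space d × ℝ}
    (hy : ‖y‖ = 1) (hF : ∀ i j, testFun hA ε i y = testFun hA ε j y) :
    y.2 ≤ totalMax hA y.1 := by
  by_contra! hlt
  have hle : ∀ i, ∀ p ∈ A i, height y p ≤ classMax hA i y.1 - y.2 := fun i p hp =>
    sub_le_sub_right (le_classMax hA y.1 hp) _
  have hM := fun i => classMax_le_totalMax hA i y.1
  have hcap : ∀ i, capTerm hA ε i (-y) = 0 := by
    intro i
    refine capTerm_eq_zero hA hε.le ?_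
    obtain ⟨p, hp⟩ := hA i
    have h1 := (le_classMax hA (-y).1 hp).trans (classMax_le_totalMax hA i (-y).1)
    have h2 : height y p < 0 := (hle i p hp).trans_lt (by linarith [hM i])
    simp only [height, Prod.fst_neg, Prod.snd_neg, inner_neg_left] at h1 h2 ⊢
    linarith
  obtain ⟨i₀, -, hmin⟩ := exists_min_image univ (fun i => classMax hA i y.1) univ_nonempty
  have hlow : classMax hA i₀ y.1 - y.2 ≤ -ε := by
    obtain ⟨i, hi⟩ := exists_class_far hAS hdisj hδ y
    obtain ⟨p, hp, e⟩ := exists_classMax hA i y.1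
    have h1 := hi p hp
    have h2 : height y p = classMax hA i y.1 - y.2 := by rw [e]; rfl
    rw [hy, mul_one, h2, abs_of_neg (by linarith [hM i])] at h1
    linarith [hmin i (mem_univ i)]
  have hN : clampSum (A i₀) ε y = -ε * n := by
    rw [← hcard i₀, clampSum_eq_iff hε]
    exact fun p hp => (hle i₀ p hp).trans hlow
  have hα : 0 < y.2 - totalMax hA y.1 := by linarith
  have hF' : ∀ i, clampSum (A i) ε y + (y.2 - totalMax hA y.1) * classMax hA i y.1
      - max 0 (y.2 - totalMax hA y.1 - ε) * (i : ℕ)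
      = -ε * n + (y.2 - totalMax hA y.1) * classMax hA i₀ y.1
      - max 0 (y.2 - totalMax hA y.1 - ε) * (i₀ : ℕ) := by
    intro i
    have h := hF i i₀
    rw [testFun, testFun, hcap, hcap, capTerm, capTerm, max_eq_right hα.le, hN] at h
    linarith
  rcases le_or_gt (y.2 - totalMax hA y.1) ε with hβ | hβ
  · rw [max_eq_left (by linarith)] at hF'
    -- Both the clamped sum and the maximum are smallest for `i₀`, so equal totals force equality in
    -- each.
    have heq : ∀ i, classMax hA i y.1 = classMax hA i₀ y.1 := by
      intro i
      refine le_antisymm ?_ (hmin i (mem_univ i))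
      have h1 := le_clampSum (A i) ε y
      rw [hcard] at h1
      refine le_of_mul_le_mul_left ?_ hα
      linarith [hF' i]
    have htot : totalMax hA y.1 = classMax hA i₀ y.1 := by
      obtain ⟨i, hi⟩ := exists_totalMax hA y.1
      rw [hi, heq]
    have hαε : y.2 - totalMax hA y.1 = ε := by linarith
    -- The parallel hyperplane at height `totalMax` meets every class, so it must be degenerate;
    -- then `y = (0, ε)`, against `‖y‖ = 1`.
    obtain ⟨i, hi⟩ := exists_class_far hAS hdisj hδ (y.1, totalMax hA y.1)
    obtain ⟨p, hp, e⟩ := exists_classMax hA i y.1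
    have h1 := hi p hp
    have h2 : height (y.1, totalMax hA y.1) p = 0 := by
      simp only [height]
      rw [← e, heq, htot, sub_self]
    rw [h2, abs_zero] at h1
    have h3 : ‖((y.1, totalMax hA y.1) : Space d × ℝ)‖ ≤ 0 :=
      le_of_mul_le_mul_left (by simpa using h1) hδ0
    have h4 := norm_le_zero_iff.mp h3
    have hv : y.1 = 0 := congrArg Prod.fst h4
    have hb : totalMax hA y.1 = 0 := congrArg Prod.snd h4
    rw [Prod.norm_def, hv, norm_zero, max_eq_right (norm_nonneg _), Real.norm_eq_abs] at hy
    rw [hb, sub_zero] at hαε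
    rw [hαε, abs_of_pos hε] at hy
    linarith
  · rw [max_eq_right (by linarith)] at hF'
    have hN' : ∀ i, clampSum (A i) ε y = -ε * n := by
      intro i
      rw [← hcard i, clampSum_eq_iff hε]
      exact fun p hp => (hle i p hp).trans (by linarith [hM i])
    have hmono : ∀ i j, i < j → classMax hA i y.1 < classMax hA j y.1 := by
      intro i j hij
      have h1 := hF' i
      have h2 := hF' j
      rw [hN'] at h1 h2
      have h3 : ((i : ℕ) : ℝ) < (j : ℕ) := by exact_mod_cast hij
      have h4 := mul_lt_mul_of_pos_left h3 (sub_pos.mpr hβ)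
      refine lt_of_mul_lt_mul_left ?_ hα.le
      linarith
    rcases eq_or_ne y.1 0 with hv | hv
    · have h := hmono 0 (Fin.last d) (by rw [Fin.lt_def]; simp; omega)
      rw [hv, classMax_zero, classMax_zero] at h
      exact lt_irrefl _ h
    · obtain ⟨i, j, hij, h⟩ := hperm y.1 hv
      exact absurd (hmono i j hij) h.not_gt

/-- There is an almost balanced hyperplane. -/
lemma exists_clampSum_eq {S : Finset (Space d)} {n : ℕ} (hd : 1 ≤ d) (hAS : ∀ i, A i ⊆ S)
    (hdisj : ∀ i j, i ≠ j → Disjoint (A i) (A j)) (hcard : ∀ i, (A i).card = n)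
    (hperm : ∀ v : Space d, v ≠ 0 → ∃ i j, i < j ∧ classMax hA j v ≤ classMax hA i v) {δ : ℝ}
    (hδ : ∀ T ⊆ S, T.card = d + 1 → ∀ y, ∃ p ∈ T, δ * ‖y‖ ≤ |height y p|)
    (hδ0 : 0 < δ) {ε : ℝ} (hε : 0 < ε) (hεδ : ε < δ) (hε1 : ε < 1) :
    ∃ (y : Space d × ℝ) (k : ℕ), ‖y‖ = 1 ∧ 0 < k ∧ k < n ∧
      ∀ i, clampSum (A i) ε y = ε * (2 * k - n) := by
  obtain ⟨y, hy, hzero⟩ := BorsukUlam.exists_zero_of_odd (E := Space d × ℝ) (d := d) (by simp)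
    (f := fun y j => testFun hA ε j.succ y - testFun hA ε 0 y)
    (Continuous.continuousOn (continuous_pi fun j =>
      (continuous_testFun hA ε j.succ).sub (continuous_testFun hA ε 0)))
    (fun y => by
      funext j
      simp only [testFun_neg hA hε.le, Pi.neg_apply]
      ring)
  have hF0 : ∀ i, testFun hA ε i y = testFun hA ε 0 y := by
    intro i
    refine Fin.cases rfl (fun j => ?_) i
    exact sub_eq_zero.mp (congrFun hzero j)
  have hF : ∀ i j, testFun hA ε i y = testFun hA ε j y := fun i j => by rw [hF0 i, hF0 j]
  have h1 := le_totalMax_of_testFun hA hd hAS hdisj hcard hperm hδ hδ0 hε hεδ hε1 hy hF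
  have h2 := le_totalMax_of_testFun hA hd hAS hdisj hcard hperm hδ hδ0 hε hεδ hε1 (y := -y)
    (by rwa [norm_neg]) (fun i j => by rw [testFun_neg hA hε.le, testFun_neg hA hε.le, hF i j])
  have hC : ∀ i j, clampSum (A i) ε y = clampSum (A j) ε y := by
    intro i j
    have := hF i j
    simp only [testFun, capTerm_eq_zero hA hε.le h1, capTerm_eq_zero hA hε.le h2] at this
    linarith
  -- For a class with no close point the clamp is exactly `±ε`; this makes the common value
  -- integral.
  obtain ⟨i₀, hi₀⟩ := exists_class_far hAS hdisj hδ y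
  have hK : clampSum (A i₀) ε y = ε * (2 * ((A i₀).filter fun p => 0 < height y p).card - n) := by
    rw [← hcard i₀]
    refine clampSum_eq_of_abs hε fun p hp => ?_
    have := hi₀ p hp
    rw [hy, mul_one] at this
    linarith
  -- A point attaining `totalMax` has nonnegative height. Used for `y` this excludes `k = 0`, for
  -- `-y` it excludes `k = n`.
  have hnot : ∀ z : Space d × ℝ, z.2 ≤ totalMax hA z.1 →
      ¬ ∀ i, clampSum (A i) ε z = -ε * n := by
    intro z hz h
    obtain ⟨i, hi⟩ := exists_totalMax hA z.1
    obtain ⟨p, hp, e⟩ := exists_classMax hA i z.1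
    have h3 := h i
    rw [← hcard i, clampSum_eq_iff hε] at h3
    have h4 := h3 p hp
    rw [height, ← e, ← hi] at h4
    linarith
  refine ⟨y, _, hy, ?_, ?_, fun i => (hC i i₀).trans hK⟩
  · rw [Nat.pos_iff_ne_zero]
    intro h0
    refine hnot y h1 fun i => ?_
    rw [hC i i₀, hK, h0]
    push_cast
    ring
  · have hle : ((A i₀).filter fun p => 0 < height y p).card ≤ n :=
      (card_filter_le _ _).trans (hcard i₀).le
    refine lt_of_le_of_ne hle fun h0 => ?_
    refine hnot (-y) h2 fun i => ?_
    rw [clampSum_neg _ hε.le, hC i i₀, hK, h0]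
    ring

end TestFunction

lemma mem_colorClass {S : Finset (Space d)} {c : Space d → Fin (d + 1)} {i : Fin (d + 1)}
    {p : Space d} : p ∈ colorClass S c i ↔ p ∈ S ∧ c p = i := mem_filter

end BalancedCut

/-! ### The balanced hyperplane -/

open BalancedCut Finset in
theorem mainTheorem3 (d n : ℕ) (hd : 1 ≤ d)
    (S : Finset (BalancedCut.Space d)) (c : BalancedCut.Space d → Fin (d + 1))
    (hcard : S.card = (d + 1) * n)
    (hpos : BalancedCut.GeneralPosition S)
    (hcol : ∀ i : Fin (d + 1), (BalancedCut.colorClass S c i).card = n)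
    (hperm : BalancedCut.NotPermuted S c) :
    ∃ (v : BalancedCut.Space d) (b : ℝ), BalancedCut.IsBalanced S c v b := by
  classical
  have hn : 0 < n := by
    obtain ⟨v, hv⟩ : ∃ v : Space d, v ≠ 0 :=
      ⟨EuclideanSpace.single ⟨0, hd⟩ 1, by simp⟩
    obtain ⟨i, -, -, p, hp, -⟩ := hperm v hv
    rw [← hcol i]
    exact card_pos.mpr ⟨p, hp.1⟩
  have hA : ∀ i, (colorClass S c i).Nonempty := fun i => card_pos.mp (by rw [hcol]; exact hn)
  have hAS : ∀ i, colorClass S c i ⊆ S := fun i => filter_subset _ _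
  have hdisj : ∀ i j, i ≠ j → Disjoint (colorClass S c i) (colorClass S c j) := by
    intro i j hij
    rw [disjoint_left]
    intro p hp hq
    exact hij ((mem_colorClass.mp hp).2.symm.trans (mem_colorClass.mp hq).2)
  have hperm' : ∀ v : Space d, v ≠ 0 → ∃ i j, i < j ∧ classMax hA j v ≤ classMax hA i v := by
    intro v hv
    obtain ⟨i, j, hij, p, hp, hq⟩ := hperm v hv
    exact ⟨i, j, hij, sup'_le _ _ fun q hq' => (hq q hq').trans (le_classMax hA v hp.1)⟩
  obtain ⟨δ, hδ0, hδ⟩ := exists_height_bound hpos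
  obtain ⟨R, hR⟩ : ∃ R, ∀ p ∈ S, ‖p‖ + 1 ≤ R := by
    obtain ⟨R, hR⟩ := (S.image fun p => ‖p‖ + 1).bddAbove
    exact ⟨R, fun p hp => hR (by simpa using ⟨p, hp, rfl⟩)⟩
  obtain ⟨ε, ⟨hε1, hεδ, hεR⟩, hε⟩ : ∃ ε : ℝ, (ε < 1 ∧ ε < δ ∧ 2 * ε * R < δ * δ) ∧ 0 < ε := by
    have hlim : Filter.Tendsto (fun ε : ℝ => 2 * ε * R) (nhds 0) (nhds 0) := by
      have : Continuous fun ε : ℝ => 2 * ε * R := by fun_prop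
      simpa using this.tendsto 0
    have h : ∀ᶠ ε : ℝ in nhds 0, ε < 1 ∧ ε < δ ∧ 2 * ε * R < δ * δ :=
      (eventually_lt_nhds one_pos).and ((eventually_lt_nhds hδ0).and
        (hlim.eventually_lt_const (mul_pos hδ0 hδ0)))
    exact ((h.filter_mono nhdsWithin_le_nhds).and
      (self_mem_nhdsWithin : Set.Ioi (0 : ℝ) ∈ nhdsWithin 0 (Set.Ioi 0))).exists
  obtain ⟨y, k, hy, hk, hkn, hC⟩ :=
    exists_clampSum_eq hA hd hAS hdisj hcol hperm' hδ hδ0 hε hεδ hε1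
  -- `B i` is the set meant to end up above: all points clearly above, and enough close ones to make
  -- `k`.
  have hB : ∀ i, ∃ B, (colorClass S c i).filter (fun p => ε ≤ height y p) ⊆ B ∧
      B ⊆ (colorClass S c i).filter (fun p => -ε < height y p) ∧ B.card = k := by
    intro i
    have h := card_le_of_clampSum (A := colorClass S c i) (k := k) hε (by rw [hC, hcol])
    refine exists_subsuperset_card_eq ?_ h.1 h.2
    exact monotone_filter_right _ fun p _ hp => (neg_lt_self hε).trans_le hp
  choose B hB1 hB2 hB3 using hB
  have hBA : ∀ i, B i ⊆ colorClass S c i := fun i => (hB2 i).trans (filter_subset _ _)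
  have hmem : ∀ i, ∀ p ∈ colorClass S c i, (p ∈ univ.biUnion B ↔ p ∈ B i) := by
    intro i p hp
    rw [mem_biUnion]
    refine ⟨fun ⟨j, _, hj⟩ => ?_, fun h => ⟨i, mem_univ i, h⟩⟩
    rwa [← (mem_colorClass.mp hp).2, (mem_colorClass.mp (hBA j hj)).2]
  have hmemS : ∀ p ∈ S, (p ∈ univ.biUnion B ↔ p ∈ B (c p)) := fun p hp =>
    hmem (c p) p (mem_colorClass.mpr ⟨hp, rfl⟩)
  obtain ⟨z, hz⟩ := exists_perturbation hpos (by rw [hcard]; exact Nat.le_mul_of_pos_right _ hn)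
    hδ hδ0 hR hε hεδ hεR hy (univ.biUnion B)
    (fun p hp h => (mem_filter.mp (hB2 _ ((hmemS p hp).mp h))).2)
    (fun p hp h => by
      by_contra! hle
      exact h ((hmemS p hp).mpr
        (hB1 _ (mem_filter.mpr ⟨mem_colorClass.mpr ⟨hp, rfl⟩, hle⟩))))
  have habove : ∀ i, (colorClass S c i).filter (fun x => z.2 < inner ℝ z.1 x) = B i := by
    intro i
    ext p
    rw [mem_filter]
    constructor
    · rintro ⟨hp, h⟩
      rw [← hmem i p hp]
      by_contra hpB
      have := (hz p (hAS i hp)).2 hpB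
      rw [height] at this
      linarith
    · intro h
      have hp := hBA i h
      refine ⟨hp, ?_⟩
      have := (hz p (hAS i hp)).1 ((hmem i p hp).mpr h)
      rw [height] at this
      linarith
  have hbelow : ∀ i, (colorClass S c i).filter (fun x => inner ℝ z.1 x < z.2)
      = colorClass S c i \ B i := by
    intro i
    ext p
    rw [mem_filter, mem_sdiff]
    refine and_congr_right fun hp => ?_
    rw [← hmem i p hp]
    have := hz p (hAS i hp)
    simp only [height, sub_pos, sub_neg] at this
    refine ⟨fun h hpB => ?_, this.2⟩
    exact absurd (this.1 hpB) h.not_gt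
  have hcardbelow : ∀ i, (colorClass S c i \ B i).card = n - k := by
    intro i
    rw [card_sdiff_of_subset (hBA i), hcol, hB3]
  refine ⟨z.1, z.2, ?_, ?_, ⟨k, hk, fun i => ?_⟩, ⟨n - k, by omega, fun i => ?_⟩⟩
  -- With points strictly on both sides the normal cannot vanish; this uses `0 < k < n`.
  · intro hv
    obtain ⟨p, hp⟩ := card_pos.mp ((hB3 0).symm ▸ hk)
    obtain ⟨q, hq⟩ := card_pos.mp (show 0 < (colorClass S c 0 \ B 0).card by
      rw [hcardbelow]; omega)
    rw [← habove] at hp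
    rw [← hbelow] at hq
    have h1 := (mem_filter.mp hp).2
    have h2 := (mem_filter.mp hq).2
    rw [hv, inner_zero_left] at h1 h2
    linarith
  · intro p hp h
    have := hz p hp
    rw [height, h, sub_self] at this
    by_cases hpB : p ∈ univ.biUnion B
    · exact lt_irrefl _ (this.1 hpB)
    · exact lt_irrefl _ (this.2 hpB)
  · rw [habove, hB3]
  · rw [hbelow, hcardbelow]
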